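/- Let $P_0^*,P_1^*$ be mutually absolutely continuous probability measures (the nominal distributions) on a measurable space $(\mathcal Y,\mathcal A)$, let $\pi_0,\pi_1>0$ with $\pi_0+\pi_1=1$ be the prior probabilities of two hypotheses $H_0,H_1$, and let $\epsilon_0,\epsilon_1\in[0,1)$. For $i=0,1$ let $$\mathcal P_i=\{(1-\epsilon_i)P_i^*+\epsilon_i R : R \text{ a probability measure on } (\mathcal Y,\mathcal A)\},$$ and assume $\mathcal P_0\cap\mathcal P_1=\emptyset$. Consider an infinite tandem of agents $k=1,2,\dots$. Under $H_i$ the observations $Y_1,Y_2,\dots$ are independent, $Y_k$ having some unknown distribution $P_{i,k}\in\mathcal P_i$, which may vary with $k$. Agent $k$ decides $U_k=\phi_k(Y_k,U_{k-1})\in\{0,1\}$, where $U_0=0$ and $\phi_k:\mathcal Y\times\{0,1\}\to\{0,1\}$ is measurable. Put $$P_k^{\mathrm{SL}}(\phi_k\mid\phi_1,\dots,\phi_{k-1})=\sup\Big\{\pi_0\,(P_{0,1}\times\cdots\times P_{0,k})(U_k=1)+\pi_1\,(P_{1,1}\times\cdots\times P_{1,k})(U_k=0)\Big\},$$ the supremum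 being over all $P_{0,1},\dots,P_{0,k}\in\mathcal P_0$ and $P_{1,1},\dots,P_{1,k}\in\mathcal P_1$. Suppose that the rules are chosen sequentially and myopically: for every $k\ge1$, given $\phi_1,\dots,\phi_{k-1}$, the rule $\phi_k$ minimizes $P_k^{\mathrm{SL}}(\,\cdot\mid\phi_1,\dots,\phi_{k-1})$ over all measurable rules. Then $$P_k^{\mathrm{SL}}(\phi_k\mid\phi_1,\dots,\phi_{k-1})\to0\quad\text{as }k\to\infty$$ if and only if $\epsilon_0=\epsilon_1=0$ and the log-likelihood ratio $\log\frac{dP_1^*}{dP_0^*}$ is essentially unbounded both from above and from below. -/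

import Mathlib

open MeasureTheory Filter Topology

noncomputable section

namespace TandemLearning

variable {Y : Type*} [MeasurableSpace Y]

/-- The `ε`-contamination class of a nominal distribution `P`: all measures
`(1 - ε) P + ε R` with `R` an arbitrary probability measure (used for `0 ≤ ε < 1`). -/
def contaminationClass (ε : ℝ) (P : Measure Y) : Set (Measure Y) :=
  {Q | ∃ R : Measure Y, IsProbabilityMeasure R ∧
    Q = ENNReal.ofReal (1 - ε) • P + ENNReal.ofReal ε • R}

/-- The decision `U_n` of the `n`-th agent as a function of the first `n` observations.
`U_0 = 0` and `U_{n+1}` is obtained by applying the rule of agent `n + 1`, which is `φ n`, to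
its own observation and to `U_n`. Hypotheses `H_0`, `H_1` are coded by `false`, `true`. -/
def decision (φ : ℕ → Y × Bool → Bool) : (n : ℕ) → (Fin n → Y) → Bool
  | 0, _ => false
  | n + 1, y => φ n (y (Fin.last n), decision φ n (fun i => y i.castSucc))

/-- False alarm probability of agent `n` when the observations are independent, with
distributions `P 0, …, P (n - 1)`. -/
def falseAlarm (φ : ℕ → Y × Bool → Bool) (n : ℕ) (P : Fin n → Measure Y) : ℝ :=
  (Measure.pi P).real {y | decision φ n y = true}

/-- Missed detection probability of agent `n` when the observations are independent, with
distributions `P 0, …, P (n - 1)`. -/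
def missedDetection (φ : ℕ → Y × Bool → Bool) (n : ℕ) (P : Fin n → Measure Y) : ℝ :=
  (Measure.pi P).real {y | decision φ n y = false}

/-- Error probability of agent `n` when the observations of the first `n` agents have
distributions `Q₀ j` under `H_0` and `Q₁ j` under `H_1`. -/
def errorProb (π₀ π₁ : ℝ) (φ : ℕ → Y × Bool → Bool) (n : ℕ) (Q₀ Q₁ : Fin n → Measure Y) : ℝ :=
  π₀ * falseAlarm φ n Q₀ + π₁ * missedDetection φ n Q₁

/-- Maximal error probability of agent `n`: the supremum over all choices, separately for each
of the first `n` agents, of observation distributions in the two contamination classes. -/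
def maxError (π₀ π₁ ε₀ ε₁ : ℝ) (P₀ P₁ : Measure Y) (φ : ℕ → Y × Bool → Bool) (n : ℕ) : ℝ :=
  sSup {e | ∃ Q₀ Q₁ : Fin n → Measure Y,
    (∀ j, Q₀ j ∈ contaminationClass ε₀ P₀) ∧ (∀ j, Q₁ j ∈ contaminationClass ε₁ P₁) ∧
    e = errorProb π₀ π₁ φ n Q₀ Q₁}

/-- The rules are chosen sequentially and myopically: for every `k`, given the rules
`φ 0, …, φ (k - 1)` of the first `k` agents, the rule `φ k` of agent `k + 1` minimizes the maximal
error probability of agent `k + 1` among all (measurable) rules `ψ`. -/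
def IsMyopicallyOptimal (π₀ π₁ ε₀ ε₁ : ℝ) (P₀ P₁ : Measure Y) (φ : ℕ → Y × Bool → Bool) : Prop :=
  ∀ k, Measurable (φ k) ∧ ∀ ψ : Y × Bool → Bool, Measurable ψ →
    maxError π₀ π₁ ε₀ ε₁ P₀ P₁ φ (k + 1) ≤
      maxError π₀ π₁ ε₀ ε₁ P₀ P₁ (Function.update φ k ψ) (k + 1)

/-- The log-likelihood ratio of `P₁` versus `P₀` is (essentially) unbounded, both from above and
from below. -/
def UnboundedLLR (P₀ P₁ : Measure Y) : Prop :=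
  (∀ c : ℝ, ¬ ∀ᵐ y ∂P₀, llr P₁ P₀ y ≤ c) ∧ (∀ c : ℝ, ¬ ∀ᵐ y ∂P₀, c ≤ llr P₁ P₀ y)

end TandemLearning

end

noncomputable section

namespace TandemLearning

/-! If learning occurs, neither decision can eventually be copied almost surely. Otherwise its
probability under the hypothesis where it is wrong is eventually nondecreasing with limit 0, hence
0; by absolute continuity it is also 0 under the other hypothesis, so the opposite error is 1
(`not_eventually_le_succ`). Two situations force copying. With a positive contamination radius, a
point mass at any observation that overturns `b` costs a fixed error, so eventually no such
observation exists (`eventually_region_eq_empty`). With no contamination the rules are greedy for a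
Bayes error. If the likelihood ratio is bounded on one side, the belief carried by one of the
decisions eventually outweighs every observation (`IsGreedy.not_learning_of_bounded`). Conversely,
the greedy Bayes error decreases to a limit, so the gain from any deviation is asymptotically
nonpositive. Switching on an event of huge likelihood ratio would gain a fixed amount if an error
probability stayed large (`IsGreedy.tendsto_decisionProb`). -/

lemma decision_congr {Y : Type*} {φ ψ : ℕ → Y × Bool → Bool} {n : ℕ}
    (h : ∀ k < n, φ k = ψ k) : decision φ n = decision ψ n := by
  induction n with
  | zero => rfl
  | succ n ih =>
    funext y
    simp only [decision]
    rw [h n (Nat.lt_succ_self n), ih fun k hk => h k (Nat.lt_succ_of_lt hk)]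

/-! ### Recursion for decision probabilities; copying excludes learning. -/

section Recursion

variable {Y : Type*} [MeasurableSpace Y]

/-- Probability that agent `n` decides `b` when the observations are independent with
distributions `Q`. -/
def decisionProb (φ : ℕ → Y × Bool → Bool) (n : ℕ) (Q : Fin n → Measure Y) (b : Bool) : ℝ :=
  (Measure.pi Q).real {y | decision φ n y = b}

lemma measurable_decision {φ : ℕ → Y × Bool → Bool} (hφ : ∀ k, Measurable (φ k)) (n : ℕ) :
    Measurable (decision φ n) := by
  induction n with
  | zero => exact measurable_const
  | succ n ih =>
    exact (hφ n).comp ((measurable_pi_apply _).prodMk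
      (ih.comp (measurable_pi_iff.2 fun _ => measurable_pi_apply _)))

/-- The first `n` agents never use rule `n`, so replacing it alters only the last transition. -/
lemma decisionProb_update (φ : ℕ → Y × Bool → Bool) (n : ℕ) (ψ : Y × Bool → Bool)
    (Q : Fin n → Measure Y) (b : Bool) :
    decisionProb (Function.update φ n ψ) n Q b = decisionProb φ n Q b := by
  unfold decisionProb
  rw [decision_congr fun k hk => Function.update_of_ne hk.ne ψ φ]

lemma decisionProb_nonneg (φ : ℕ → Y × Bool → Bool) (n : ℕ) (Q : Fin n → Measure Y) (b : Bool) :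
    0 ≤ decisionProb φ n Q b := measureReal_nonneg

lemma decisionProb_le_one (φ : ℕ → Y × Bool → Bool) (n : ℕ) (Q : Fin n → Measure Y)
    [∀ i, IsProbabilityMeasure (Q i)] (b : Bool) : decisionProb φ n Q b ≤ 1 := measureReal_le_one

lemma decisionProb_not {φ : ℕ → Y × Bool → Bool} (hφ : ∀ k, Measurable (φ k)) (n : ℕ)
    (Q : Fin n → Measure Y) [∀ i, IsProbabilityMeasure (Q i)] (b : Bool) :
    decisionProb φ n Q (!b) = 1 - decisionProb φ n Q b := by
  unfold decisionProb
  have hb : MeasurableSet {y | decision φ n y = b} :=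
    measurable_decision hφ n (measurableSet_singleton b)
  rw [← probReal_compl_eq_one_sub hb]
  congr 1
  ext y
  cases b <;> simp

/-- Total probability formula over the decision of the previous agent. -/
lemma decisionProb_succ {φ : ℕ → Y × Bool → Bool} (hφ : ∀ k, Measurable (φ k)) (n : ℕ)
    (Q : Fin (n + 1) → Measure Y) [∀ i, IsProbabilityMeasure (Q i)] (b c : Bool) :
    decisionProb φ (n + 1) Q c =
      (Q (Fin.last n)).real {y | φ n (y, b) = c} * decisionProb φ n (fun i => Q i.castSucc) b +
      (Q (Fin.last n)).real {y | φ n (y, !b) = c} *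
        decisionProb φ n (fun i => Q i.castSucc) (!b) := by
  have hd := measurable_decision hφ n
  have hA (d : Bool) : MeasurableSet {y | φ n (y, d) = c} :=
    ((hφ n).comp (measurable_id.prodMk measurable_const)) (measurableSet_singleton c)
  have hD (d : Bool) : MeasurableSet {y | decision φ n y = d} := hd (measurableSet_singleton d)
  have hmp := measurePreserving_piFinSuccAbove Q (Fin.last n)
  -- Splitting off the last coordinate turns the event into two disjoint rectangles.
  have hset : {y | decision φ (n + 1) y = c} =
      (MeasurableEquiv.piFinSuccAbove (fun _ => Y) (Fin.last n)) ⁻¹'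
        ({y | φ n (y, b) = c} ×ˢ {y | decision φ n y = b} ∪
          {y | φ n (y, !b) = c} ×ˢ {y | decision φ n y = !b}) := by
    ext y
    have h1 : (MeasurableEquiv.piFinSuccAbove (fun _ => Y) (Fin.last n)) y =
        (y (Fin.last n), fun i : Fin n => y i.castSucc) := by
      simp only [MeasurableEquiv.piFinSuccAbove_apply, Fin.insertNthEquiv, Equiv.coe_fn_symm_mk,
        Prod.mk.injEq, true_and]
      funext i
      simp [Fin.removeNth]
    simp only [Set.mem_ofPred_eq, Set.mem_preimage, h1, Set.mem_union, Set.mem_prod, decision]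
    cases decision φ n (fun i : Fin n => y i.castSucc) <;> cases b <;> simp
  have hdisj : Disjoint ({y | φ n (y, b) = c} ×ˢ {y | decision φ n y = b})
      ({y | φ n (y, !b) = c} ×ˢ {y | decision φ n y = !b}) := by
    rw [Set.disjoint_left]
    rintro ⟨x, y⟩ ⟨-, h1⟩ ⟨-, h2⟩
    simp only [Set.mem_ofPred_eq] at h1 h2
    rw [h1] at h2
    cases b <;> simp at h2
  unfold decisionProb
  rw [hset, hmp.measureReal_preimage
    (((hA b).prod (hD b)).union ((hA (!b)).prod (hD (!b)))).nullMeasurableSet,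
    measureReal_union hdisj ((hA (!b)).prod (hD (!b))), measureReal_prod_prod,
    measureReal_prod_prod]
  simp only [Fin.succAbove_last]

/-- Replacing the observation distributions by one that dominates preserves null decisions. -/
lemma decisionProb_eq_zero_of_ac {φ : ℕ → Y × Bool → Bool} (hφ : ∀ k, Measurable (φ k))
    {μ ν : Measure Y} [IsProbabilityMeasure μ] [IsProbabilityMeasure ν] (h : ν ≪ μ) (n : ℕ)
    (b : Bool) (h0 : decisionProb φ n (fun _ => μ) b = 0) :
    decisionProb φ n (fun _ => ν) b = 0 := by
  induction n generalizing b with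
  | zero =>
    unfold decisionProb at h0 ⊢
    -- With no coordinates, both product measures are the same Dirac mass.
    rwa [Measure.pi_of_empty] at h0 ⊢
  | succ n ih =>
    rw [decisionProb_succ hφ n _ b b] at h0 ⊢
    have key (d : Bool) (h : μ.real {y | φ n (y, d) = b} * decisionProb φ n (fun _ => μ) d = 0) :
        ν.real {y | φ n (y, d) = b} * decisionProb φ n (fun _ => ν) d = 0 := by
      rcases mul_eq_zero.1 h with h | h
      · rw [measureReal_eq_zero_iff] at h
        rw [(measureReal_eq_zero_iff).2 (‹ν ≪ μ› h), zero_mul]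
      · rw [ih d h, mul_zero]
    have hn (d : Bool) : 0 ≤ μ.real {y | φ n (y, d) = b} * decisionProb φ n (fun _ => μ) d :=
      mul_nonneg measureReal_nonneg (decisionProb_nonneg ..)
    rw [key b (le_antisymm (by linarith [hn (!b)]) (hn b)),
      key (!b) (le_antisymm (by linarith [hn b]) (hn (!b))), add_zero]

/-- If a decision is copied almost surely, its probability does not decrease. -/
lemma decisionProb_le_succ {φ : ℕ → Y × Bool → Bool} (hφ : ∀ k, Measurable (φ k))
    (μ : Measure Y) [IsProbabilityMeasure μ] (n : ℕ) (b : Bool)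
    (h : μ {y | φ n (y, b) = !b} = 0) :
    decisionProb φ n (fun _ => μ) b ≤ decisionProb φ (n + 1) (fun _ => μ) b := by
  have hA : MeasurableSet {y | φ n (y, b) = !b} :=
    ((hφ n).comp (measurable_id.prodMk measurable_const)) (measurableSet_singleton _)
  have h1 : μ.real {y | φ n (y, b) = b} = 1 := by
    have : {y | φ n (y, b) = b} = {y | φ n (y, b) = !b}ᶜ := by
      ext y
      cases b <;> simp
    rw [this, probReal_compl_eq_one_sub hA, measureReal_def, h]
    simp
  rw [decisionProb_succ hφ n _ b b, h1, one_mul]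
  exact le_add_of_nonneg_right (mul_nonneg measureReal_nonneg (decisionProb_nonneg ..))

/-- If both error probabilities vanish in the limit, neither of them is eventually
nondecreasing. -/
lemma not_eventually_le_succ {φ : ℕ → Y × Bool → Bool} (hφ : ∀ k, Measurable (φ k))
    {μ ν : Measure Y} [IsProbabilityMeasure μ] [IsProbabilityMeasure ν] (hac : ν ≪ μ) (b : Bool)
    (hμ : Tendsto (fun n => decisionProb φ n (fun _ => μ) b) atTop (𝓝 0))
    (hν : Tendsto (fun n => decisionProb φ n (fun _ => ν) (!b)) atTop (𝓝 0)) :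
    ¬ ∀ᶠ n in atTop, decisionProb φ n (fun _ => μ) b ≤ decisionProb φ (n + 1) (fun _ => μ) b := by
  intro hmono
  obtain ⟨N, hN⟩ := eventually_atTop.1 hmono
  have hzero : ∀ n ≥ N, decisionProb φ n (fun _ => μ) b = 0 := by
    intro n hn
    refine le_antisymm (ge_of_tendsto hμ ?_) (decisionProb_nonneg ..)
    filter_upwards [eventually_ge_atTop n] with m hm
    induction m, hm using Nat.le_induction with
    | base => exact le_rfl
    | succ m hm ih => exact ih.trans (hN m (hn.trans hm))
  -- Here the `ν`-probability of `!b` is below 1, while that of `b` is 0.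
  obtain ⟨n, hn, hnN⟩ := ((hν.eventually (gt_mem_nhds one_pos)).and (eventually_ge_atTop N)).exists
  rw [decisionProb_not hφ, decisionProb_eq_zero_of_ac hφ hac n b (hzero n hnN)] at hn
  linarith

end Recursion

/-! ### Contamination classes and their obstruction to learning. -/

section Contamination

variable {Y : Type*} [MeasurableSpace Y]

lemma ofReal_one_sub_add {ε : ℝ} (h0 : 0 ≤ ε) (h1 : ε < 1) :
    ENNReal.ofReal (1 - ε) + ENNReal.ofReal ε = 1 := by
  rw [← ENNReal.ofReal_add (by linarith) h0]
  simp

lemma isProbabilityMeasure_of_mem {ε : ℝ} (h0 : 0 ≤ ε) (h1 : ε < 1) {P Q : Measure Y}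
    [IsProbabilityMeasure P] (hQ : Q ∈ contaminationClass ε P) : IsProbabilityMeasure Q := by
  obtain ⟨R, hR, rfl⟩ := hQ
  exact ⟨by simp [ofReal_one_sub_add h0 h1]⟩

lemma self_mem_contaminationClass {ε : ℝ} (h0 : 0 ≤ ε) (h1 : ε < 1) (P : Measure Y)
    [IsProbabilityMeasure P] : P ∈ contaminationClass ε P :=
  ⟨P, inferInstance, by rw [← add_smul, ofReal_one_sub_add h0 h1, one_smul]⟩

lemma contaminationClass_zero (P : Measure Y) [IsProbabilityMeasure P] :
    contaminationClass 0 P = {P} := by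
  ext Q
  constructor
  · rintro ⟨R, -, rfl⟩
    simp
  · rintro rfl
    exact self_mem_contaminationClass le_rfl one_pos Q

/-- The contaminant is a point mass in `A`, so even nominally null sets receive mass `ε`. -/
lemma exists_mem_contaminationClass_le (ε : ℝ) (P : Measure Y)
    {A : Set Y} (hA : A.Nonempty) :
    ∃ Q ∈ contaminationClass ε P, ENNReal.ofReal ε ≤ Q A := by
  obtain ⟨y, hy⟩ := hA
  refine ⟨_, ⟨Measure.dirac y, inferInstance, rfl⟩, ?_⟩
  simp [Measure.dirac_apply_of_mem hy]

lemma errorProb_le_maxError {π₀ π₁ ε₀ ε₁ : ℝ} (hπ₀ : 0 ≤ π₀) (hπ₁ : 0 ≤ π₁)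
    (hε₀ : 0 ≤ ε₀ ∧ ε₀ < 1) (hε₁ : 0 ≤ ε₁ ∧ ε₁ < 1) (P₀ P₁ : Measure Y)
    [IsProbabilityMeasure P₀] [IsProbabilityMeasure P₁] (φ : ℕ → Y × Bool → Bool) (n : ℕ)
    {Q₀ Q₁ : Fin n → Measure Y} (hQ₀ : ∀ j, Q₀ j ∈ contaminationClass ε₀ P₀)
    (hQ₁ : ∀ j, Q₁ j ∈ contaminationClass ε₁ P₁) :
    π₀ * decisionProb φ n Q₀ true + π₁ * decisionProb φ n Q₁ false ≤
      maxError π₀ π₁ ε₀ ε₁ P₀ P₁ φ n := by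
  refine le_csSup ⟨π₀ + π₁, ?_⟩ ⟨Q₀, Q₁, hQ₀, hQ₁, rfl⟩
  rintro e ⟨R₀, R₁, hR₀, hR₁, rfl⟩
  have := fun j => isProbabilityMeasure_of_mem hε₀.1 hε₀.2 (hR₀ j)
  have := fun j => isProbabilityMeasure_of_mem hε₁.1 hε₁.2 (hR₁ j)
  exact add_le_add (mul_le_of_le_one_right hπ₀ (decisionProb_le_one φ n R₀ true))
    (mul_le_of_le_one_right hπ₁ (decisionProb_le_one φ n R₁ false))

lemma maxError_zero_zero (π₀ π₁ : ℝ) (P₀ P₁ : Measure Y)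
    [IsProbabilityMeasure P₀] [IsProbabilityMeasure P₁] (φ : ℕ → Y × Bool → Bool) (n : ℕ) :
    maxError π₀ π₁ 0 0 P₀ P₁ φ n =
      π₀ * decisionProb φ n (fun _ => P₀) true + π₁ * decisionProb φ n (fun _ => P₁) false := by
  have : {e | ∃ Q₀ Q₁ : Fin n → Measure Y,
      (∀ j, Q₀ j ∈ contaminationClass 0 P₀) ∧ (∀ j, Q₁ j ∈ contaminationClass 0 P₁) ∧
      e = errorProb π₀ π₁ φ n Q₀ Q₁} = {errorProb π₀ π₁ φ n (fun _ => P₀) (fun _ => P₁)} := by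
    ext e
    simp only [contaminationClass_zero, Set.mem_singleton_iff, Set.mem_ofPred_eq]
    constructor
    · rintro ⟨Q₀, Q₁, h₀, h₁, rfl⟩
      rw [funext h₀, funext h₁]
    · rintro rfl
      exact ⟨_, _, fun _ => rfl, fun _ => rfl, rfl⟩
  unfold maxError
  rw [this, csSup_singleton]
  rfl

/-- If decision `!b` has uniformly vanishing probability over a contamination class with positive
radius, then agents who receive `b` eventually copy it, whatever they observe. -/
lemma eventually_region_eq_empty {φ : ℕ → Y × Bool → Bool} (hφ : ∀ k, Measurable (φ k))
    {ε : ℝ} (h0 : 0 < ε) (h1 : ε < 1) (P : Measure Y) [IsProbabilityMeasure P] (b : Bool)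
    (h : ∀ δ > 0, ∀ᶠ n in atTop, ∀ Q : Fin n → Measure Y,
      (∀ j, Q j ∈ contaminationClass ε P) → decisionProb φ n Q (!b) < δ) :
    ∀ᶠ n in atTop, {y | φ n (y, b) = !b} = ∅ := by
  -- Under `P`, agent `n` says `b` with probability above 1/2; contaminating the next observation
  -- alone then yields `!b` with probability at least `ε / 2`.
  filter_upwards [h (1 / 2) (by norm_num), (tendsto_add_atTop_nat 1).eventually
    (h (ε / 2) (by linarith))] with n hn hn1
  by_contra hne
  obtain ⟨R, hR, hRA⟩ := exists_mem_contaminationClass_le ε P (Set.nonempty_iff_ne_empty.2 hne)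
  have hRp := isProbabilityMeasure_of_mem h0.le h1 hR
  have hP := self_mem_contaminationClass h0.le h1 P
  let Q : Fin (n + 1) → Measure Y := Fin.snoc (α := fun _ => Measure Y) (fun _ => P) R
  have hQl : Q (Fin.last n) = R := Fin.snoc_last (α := fun _ => Measure Y) _ _
  have hQc : (fun i : Fin n => Q i.castSucc) = fun _ => P :=
    funext fun i => Fin.snoc_castSucc (α := fun _ => Measure Y) _ _ _
  have hQ : ∀ j, Q j ∈ contaminationClass ε P := by
    intro j
    refine Fin.lastCases ?_ (fun i => ?_) j
    · rwa [hQl]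
    · rw [congrFun hQc i]
      exact hP
  have := fun j => isProbabilityMeasure_of_mem h0.le h1 (hQ j)
  have h2 := hn1 Q hQ
  rw [decisionProb_succ hφ n Q b, hQc, hQl] at h2
  have h3 := hn (fun _ => P) fun _ => hP
  have h4 : ε ≤ R.real {y | φ n (y, b) = !b} :=
    (ENNReal.ofReal_le_iff_le_toReal (measure_ne_top _ _)).1 hRA
  have h5 := decisionProb_not hφ n (fun _ => P) b
  have h6 : 0 ≤ R.real {y | φ n (y, !b) = !b} * decisionProb φ n (fun _ => P) (!b) :=
    mul_nonneg measureReal_nonneg (decisionProb_nonneg ..)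
  nlinarith

/-- Learning is impossible if one of the contamination classes is nontrivial. -/
lemma not_learning_of_contamination {φ : ℕ → Y × Bool → Bool} (hφ : ∀ k, Measurable (φ k))
    {ε : ℝ} (h0 : 0 < ε) (h1 : ε < 1) (P P' : Measure Y) [IsProbabilityMeasure P]
    [IsProbabilityMeasure P'] (hac : P ≪ P') (b : Bool)
    (h : ∀ δ > 0, ∀ᶠ n in atTop, ∀ Q : Fin n → Measure Y,
      (∀ j, Q j ∈ contaminationClass ε P) → decisionProb φ n Q (!b) < δ)
    (h' : Tendsto (fun n => decisionProb φ n (fun _ => P') b) atTop (𝓝 0)) : False := by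
  refine not_eventually_le_succ hφ hac b h' ?_ ?_
  · refine (tendsto_order.2 ⟨fun a ha => Eventually.of_forall fun n =>
      ha.trans_le (decisionProb_nonneg ..), fun δ hδ => ?_⟩)
    filter_upwards [h δ hδ] with n hn
    exact hn _ fun _ => self_mem_contaminationClass h0.le h1 P
  · filter_upwards [eventually_region_eq_empty hφ h0 h1 P b h] with n hn
    exact decisionProb_le_succ hφ P' n b (by rw [hn, measure_empty])

end Contamination

/-! ### Likelihood ratio bounds on events. -/

section LikelihoodRatio

variable {Y : Type*} [MeasurableSpace Y] {P₀ P₁ : Measure Y} [IsProbabilityMeasure P₀]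
  [IsProbabilityMeasure P₁]

lemma measureReal_eq_setIntegral_exp_llr (h₀₁ : P₀ ≪ P₁) (h₁₀ : P₁ ≪ P₀) (A : Set Y) :
    P₁.real A = ∫ y in A, Real.exp (llr P₁ P₀ y) ∂P₀ := by
  rw [← Measure.setIntegral_toReal_rnDeriv h₁₀]
  exact integral_congr_ae (EventuallyEq.symm (ae_restrict_of_ae (exp_llr_of_ac' P₁ P₀ h₀₁)))

lemma integrable_exp_llr (h₀₁ : P₀ ≪ P₁) :
    Integrable (fun y => Real.exp (llr P₁ P₀ y)) P₀ :=
  Measure.integrable_toReal_rnDeriv.congr (exp_llr_of_ac' P₁ P₀ h₀₁).symm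

lemma measureReal_le_exp_mul (h₀₁ : P₀ ≪ P₁) (h₁₀ : P₁ ≪ P₀) {A : Set Y} (hA : MeasurableSet A)
    {c : ℝ} (h : ∀ᵐ y ∂P₀, y ∈ A → llr P₁ P₀ y ≤ c) :
    P₁.real A ≤ Real.exp c * P₀.real A := by
  rw [measureReal_eq_setIntegral_exp_llr h₀₁ h₁₀]
  refine (setIntegral_mono_on_ae (integrable_exp_llr h₀₁).integrableOn
    (integrable_const (Real.exp c)).integrableOn hA ?_).trans_eq ?_
  · filter_upwards [h] with y hy hyA using Real.exp_le_exp.2 (hy hyA)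
  · simp [mul_comm]

lemma exp_mul_le_measureReal (h₀₁ : P₀ ≪ P₁) (h₁₀ : P₁ ≪ P₀) {A : Set Y} (hA : MeasurableSet A)
    {c : ℝ} (h : ∀ᵐ y ∂P₀, y ∈ A → c ≤ llr P₁ P₀ y) :
    Real.exp c * P₀.real A ≤ P₁.real A := by
  rw [measureReal_eq_setIntegral_exp_llr h₀₁ h₁₀]
  refine Eq.trans_le ?_ (setIntegral_mono_on_ae (integrable_const (Real.exp c)).integrableOn
    (integrable_exp_llr h₀₁).integrableOn hA ?_)
  · simp [mul_comm]
  · filter_upwards [h] with y hy hyA using Real.exp_le_exp.2 (hy hyA)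

/-- The event is a superlevel set of the log-likelihood ratio at `log K`; it is not `P₀`-null, hence
not `P₁`-null. -/
lemma exists_mul_le_of_unbounded_above (h₀₁ : P₀ ≪ P₁) (h₁₀ : P₁ ≪ P₀)
    (h : ∀ c : ℝ, ¬ ∀ᵐ y ∂P₀, llr P₁ P₀ y ≤ c) (K : ℝ) (hK : 0 < K) :
    ∃ B, MeasurableSet B ∧ 0 < P₁.real B ∧ K * P₀.real B ≤ P₁.real B := by
  have hB : MeasurableSet {y | ¬ llr P₁ P₀ y ≤ Real.log K} :=
    (measurableSet_le (measurable_llr _ _) measurable_const).compl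
  refine ⟨_, hB, ?_, ?_⟩
  · exact measureReal_nonneg.lt_of_ne' fun h0 =>
      h (Real.log K) (h₀₁ ((measureReal_eq_zero_iff).1 h0))
  · have := exp_mul_le_measureReal h₀₁ h₁₀ hB (c := Real.log K)
      (Eventually.of_forall fun y hy => (not_le.1 hy).le)
    rwa [Real.exp_log hK] at this

lemma exists_mul_le_of_unbounded_below (h₀₁ : P₀ ≪ P₁) (h₁₀ : P₁ ≪ P₀)
    (h : ∀ c : ℝ, ¬ ∀ᵐ y ∂P₀, c ≤ llr P₁ P₀ y) (K : ℝ) (hK : 0 < K) :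
    ∃ B, MeasurableSet B ∧ 0 < P₀.real B ∧ K * P₁.real B ≤ P₀.real B := by
  have hB : MeasurableSet {y | ¬ -Real.log K ≤ llr P₁ P₀ y} :=
    (measurableSet_le measurable_const (measurable_llr _ _)).compl
  refine ⟨_, hB, ?_, ?_⟩
  · exact measureReal_nonneg.lt_of_ne' fun h0 =>
      h (-Real.log K) ((measureReal_eq_zero_iff).1 h0)
  · have := measureReal_le_exp_mul h₀₁ h₁₀ hB (c := -Real.log K)
      (Eventually.of_forall fun y hy => (not_le.1 hy).le)
    rw [Real.exp_neg, Real.exp_log hK, inv_mul_eq_div, le_div_iff₀ hK] at this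
    linarith

end LikelihoodRatio

/-! ### Greedy rules for a Bayes error. -/

section Myopic

variable {Y : Type*} [MeasurableSpace Y]

/-- Bayes error of agent `n` with weight `w b` and observation distribution `μ b` under the
hypothesis that a decision `b` is wrong. -/
def bayesError (w : Bool → ℝ) (μ : Bool → Measure Y) (φ : ℕ → Y × Bool → Bool) (n : ℕ) : ℝ :=
  w true * decisionProb φ n (fun _ => μ true) true +
    w false * decisionProb φ n (fun _ => μ false) false

/-- This symmetric form lets one argument serve both decisions. -/
lemma bayesError_eq (w : Bool → ℝ) (μ : Bool → Measure Y) (φ : ℕ → Y × Bool → Bool) (n : ℕ)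
    (b : Bool) : bayesError w μ φ n =
      w b * decisionProb φ n (fun _ => μ b) b +
        w (!b) * decisionProb φ n (fun _ => μ (!b)) (!b) := by
  cases b
  · exact add_comm _ _
  · rfl

lemma bayesError_nonneg {w : Bool → ℝ} (μ : Bool → Measure Y)
    (φ : ℕ → Y × Bool → Bool) (hw : ∀ b, 0 < w b) (n : ℕ) : 0 ≤ bayesError w μ φ n :=
  add_nonneg (mul_nonneg (hw _).le (decisionProb_nonneg ..))
    (mul_nonneg (hw _).le (decisionProb_nonneg ..))

/-- Each rule minimizes the Bayes error given the preceding ones. -/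
def IsGreedy (w : Bool → ℝ) (μ : Bool → Measure Y) (φ : ℕ → Y × Bool → Bool) : Prop :=
  ∀ k ψ, Measurable ψ → bayesError w μ φ (k + 1) ≤ bayesError w μ (Function.update φ k ψ) (k + 1)

lemma measurable_update {φ : ℕ → Y × Bool → Bool} (hφ : ∀ k, Measurable (φ k)) (n : ℕ)
    {ψ : Y × Bool → Bool} (hψ : Measurable ψ) (k : ℕ) : Measurable (Function.update φ n ψ k) := by
  rcases eq_or_ne k n with rfl | hk
  · simpa using hψ
  · simpa [hk] using hφ k

variable {w : Bool → ℝ} {μ : Bool → Measure Y} [∀ b, IsProbabilityMeasure (μ b)]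
  {φ : ℕ → Y × Bool → Bool}

/-- The greedy rule is at least as good as copying the previous decision except for switching
from `b` to `!b` on the event `B`. -/
lemma IsGreedy.succ_le_of_switch (hg : IsGreedy w μ φ) (hφ : ∀ k, Measurable (φ k))
    (n : ℕ) (b : Bool) {B : Set Y} (hB : MeasurableSet B) :
    bayesError w μ φ (n + 1) ≤ bayesError w μ φ n -
      w b * ((μ b).real B * decisionProb φ n (fun _ => μ b) b) +
      w (!b) * ((μ (!b)).real B * decisionProb φ n (fun _ => μ (!b)) b) := by
  classical
  let ψ : Y × Bool → Bool := fun p => if p.2 = b ∧ p.1 ∉ B then b else !b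
  have hψ : Measurable ψ := by
    refine Measurable.ite ?_ measurable_const measurable_const
    exact (measurable_snd (measurableSet_singleton b)).inter (measurable_fst hB.compl)
  have hup := measurable_update hφ n hψ
  have h := hg n ψ hψ
  have hbb : {y | ψ (y, b) = b} = Bᶜ := by
    ext y
    by_cases hy : y ∈ B <;> simp [ψ, hy]
  have hbn : {y | ψ (y, b) = !b} = B := by
    ext y
    by_cases hy : y ∈ B <;> simp [ψ, hy]
  have hnb : {y | ψ (y, !b) = b} = ∅ := by
    ext y
    simp [ψ]
  have hnn : {y | ψ (y, !b) = !b} = Set.univ := by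
    ext y
    simp [ψ]
  rw [bayesError_eq w μ (Function.update φ n ψ) _ b, decisionProb_succ hup n _ b b,
    decisionProb_succ hup n _ b (!b)] at h
  simp only [decisionProb_update, Function.update_self, hbb, hbn, hnb, hnn, measureReal_empty,
    probReal_univ, probReal_compl_eq_one_sub hB] at h
  rw [bayesError_eq w μ φ n b]
  linarith

/-- The greedy rule is at least as good as its modification which copies `b`. -/
lemma IsGreedy.mul_le_of_copy (hg : IsGreedy w μ φ) (hφ : ∀ k, Measurable (φ k))
    (n : ℕ) (b : Bool) :
    w (!b) * ((μ (!b)).real {y | φ n (y, b) = !b} * decisionProb φ n (fun _ => μ (!b)) b) ≤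
      w b * ((μ b).real {y | φ n (y, b) = !b} * decisionProb φ n (fun _ => μ b) b) := by
  let ψ : Y × Bool → Bool := fun p => if p.2 = b then b else φ n p
  have hψ : Measurable ψ :=
    Measurable.ite (measurable_snd (measurableSet_singleton b)) measurable_const (hφ n)
  have hup := measurable_update hφ n hψ
  have h := hg n ψ hψ
  have hbb : {y | ψ (y, b) = b} = Set.univ := by
    ext y
    simp [ψ]
  have hbn : {y | ψ (y, b) = !b} = ∅ := by
    ext y
    simp [ψ]
  have hn (c : Bool) : {y | ψ (y, !b) = c} = {y | φ n (y, !b) = c} := by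
    ext y
    simp [ψ]
  have hA : MeasurableSet {y | φ n (y, b) = !b} :=
    ((hφ n).comp (measurable_id.prodMk measurable_const)) (measurableSet_singleton _)
  have hc : {y | φ n (y, b) = b} = {y | φ n (y, b) = !b}ᶜ := by
    ext y
    cases b <;> simp
  rw [bayesError_eq w μ (Function.update φ n ψ) _ b, bayesError_eq w μ φ _ b,
    decisionProb_succ hup n _ b b, decisionProb_succ hup n _ b (!b),
    decisionProb_succ hφ n _ b b, decisionProb_succ hφ n _ b (!b)] at h
  simp only [decisionProb_update, Function.update_self, hbb, hbn, hn, measureReal_empty,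
    probReal_univ, hc, probReal_compl_eq_one_sub hA] at h
  linarith

/-- Decision `b` has vanishing probability under the hypothesis for which it is wrong, if events
of arbitrarily large likelihood ratio in favour of that hypothesis exist. -/
lemma IsGreedy.tendsto_decisionProb (hg : IsGreedy w μ φ) (hφ : ∀ k, Measurable (φ k))
    (hw : ∀ b, 0 < w b) (b : Bool)
    (hB : ∀ K : ℝ, 0 < K → ∃ B, MeasurableSet B ∧ 0 < (μ b).real B ∧
      K * (μ (!b)).real B ≤ (μ b).real B) :
    Tendsto (fun n => decisionProb φ n (fun _ => μ b) b) atTop (𝓝 0) := by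
  -- Switching on the empty event is plain copying.
  have hanti : Antitone (bayesError w μ φ) := antitone_nat_of_succ_le fun n => by
    simpa using hg.succ_le_of_switch hφ n b MeasurableSet.empty
  have hlim := tendsto_atTop_ciInf hanti
    ⟨0, Set.forall_mem_range.2 (bayesError_nonneg μ φ hw)⟩
  have hdiff : Tendsto (fun n => bayesError w μ φ n - bayesError w μ φ (n + 1)) atTop (𝓝 0) := by
    simpa using hlim.sub (hlim.comp (tendsto_add_atTop_nat 1))
  refine tendsto_order.2 ⟨fun a ha => Eventually.of_forall fun n =>
    ha.trans_le (decisionProb_nonneg ..), fun δ hδ => ?_⟩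
  have hwb := hw b
  have hwn := hw (!b)
  -- This ratio makes the cost of switching at most half the gain obtained when the error
  -- probability is `δ`.
  obtain ⟨B, hBm, hBpos, hBK⟩ := hB (2 * w (!b) / (w b * δ)) (by positivity)
  have hBK' : w (!b) * (μ (!b)).real B ≤ w b * δ / 2 * (μ b).real B := by
    rw [div_mul_eq_mul_div, div_le_iff₀ (by positivity)] at hBK
    linarith
  filter_upwards [hdiff.eventually (gt_mem_nhds (show 0 < w b * δ / 2 * (μ b).real B by
    positivity))] with n hn
  have h1 := hg.succ_le_of_switch hφ n b hBm
  have h2 : w (!b) * ((μ (!b)).real B * decisionProb φ n (fun _ => μ (!b)) b) ≤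
      w (!b) * (μ (!b)).real B :=
    mul_le_mul_of_nonneg_left
      (mul_le_of_le_one_right measureReal_nonneg (decisionProb_le_one ..)) hwn.le
  have h3 : w b * (μ b).real B * decisionProb φ n (fun _ => μ b) b < w b * (μ b).real B * δ := by
    linarith
  exact lt_of_mul_lt_mul_left h3 (by positivity)

/-- Greedy learning is impossible if the likelihood ratio is bounded on one side. -/
lemma IsGreedy.not_learning_of_bounded (hg : IsGreedy w μ φ) (hφ : ∀ k, Measurable (φ k))
    (hw : ∀ b, 0 < w b) (b : Bool) (hac : ∀ b c, μ b ≪ μ c) {C : ℝ}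
    (hC : ∀ A, MeasurableSet A → (μ b).real A ≤ C * (μ (!b)).real A)
    (h : ∀ c, Tendsto (fun n => decisionProb φ n (fun _ => μ c) c) atTop (𝓝 0)) : False := by
  refine not_eventually_le_succ hφ (hac (!b) b) b (h b) (h (!b)) ?_
  have hwb := hw b
  have hwn := hw (!b)
  -- Once this sum is below `w (!b)`, the prior odds given `b` beat the factor `C`, and overturning
  -- `b` on a non-null event would be worse than copying.
  have hlim : Tendsto (fun n => w b * C * decisionProb φ n (fun _ => μ b) b +
      w (!b) * decisionProb φ n (fun _ => μ (!b)) (!b)) atTop (𝓝 0) := by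
    simpa using ((h b).const_mul (w b * C)).add ((h (!b)).const_mul (w (!b)))
  filter_upwards [hlim.eventually (gt_mem_nhds hwn)] with n hn
  have hA : MeasurableSet {y | φ n (y, b) = !b} :=
    ((hφ n).comp (measurable_id.prodMk measurable_const)) (measurableSet_singleton _)
  have h1 := hg.mul_le_of_copy hφ n b
  have h2 := hC _ hA
  rw [decisionProb_not hφ n _ b] at hn
  have h3 : w b * ((μ b).real {y | φ n (y, b) = !b} * decisionProb φ n (fun _ => μ b) b) ≤
      w b * ((C * (μ (!b)).real {y | φ n (y, b) = !b}) * decisionProb φ n (fun _ => μ b) b) :=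
    mul_le_mul_of_nonneg_left (mul_le_mul_of_nonneg_right h2 (decisionProb_nonneg ..)) hwb.le
  have h4 : (μ (!b)).real {y | φ n (y, b) = !b} = 0 := by
    by_contra hne
    have hpos : 0 < (μ (!b)).real {y | φ n (y, b) = !b} :=
      lt_of_le_of_ne measureReal_nonneg (Ne.symm hne)
    have := mul_lt_mul_of_pos_left hn hpos
    linarith
  exact decisionProb_le_succ hφ (μ b) n b (hac b (!b) ((measureReal_eq_zero_iff).1 h4))

end Myopic

/-! ### From maximal error to the two error probabilities, and the equivalence. -/

section Learning

variable {Y : Type*} [MeasurableSpace Y]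

/-- A vanishing maximal error makes both error probabilities vanish uniformly over the
contamination classes. -/
lemma eventually_decisionProb_lt {π₀ π₁ ε₀ ε₁ : ℝ} (hπ₀ : 0 < π₀) (hπ₁ : 0 < π₁)
    (hε₀ : 0 ≤ ε₀ ∧ ε₀ < 1) (hε₁ : 0 ≤ ε₁ ∧ ε₁ < 1) (P₀ P₁ : Measure Y)
    [IsProbabilityMeasure P₀] [IsProbabilityMeasure P₁] (φ : ℕ → Y × Bool → Bool)
    (h : Tendsto (fun n => maxError π₀ π₁ ε₀ ε₁ P₀ P₁ φ n) atTop (𝓝 0)) {δ : ℝ} (hδ : 0 < δ) :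
    (∀ᶠ n in atTop, ∀ Q : Fin n → Measure Y, (∀ j, Q j ∈ contaminationClass ε₀ P₀) →
      decisionProb φ n Q true < δ) ∧
    (∀ᶠ n in atTop, ∀ Q : Fin n → Measure Y, (∀ j, Q j ∈ contaminationClass ε₁ P₁) →
      decisionProb φ n Q false < δ) := by
  constructor
  · filter_upwards [h.eventually (gt_mem_nhds (mul_pos hπ₀ hδ))] with n hn Q hQ
    have h1 := errorProb_le_maxError hπ₀.le hπ₁.le hε₀ hε₁ P₀ P₁ φ n hQ
      (fun _ => self_mem_contaminationClass hε₁.1 hε₁.2 P₁)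
    have h2 := mul_nonneg hπ₁.le (decisionProb_nonneg φ n (fun _ => P₁) false)
    exact lt_of_mul_lt_mul_left (by linarith) hπ₀.le
  · filter_upwards [h.eventually (gt_mem_nhds (mul_pos hπ₁ hδ))] with n hn Q hQ
    have h1 := errorProb_le_maxError hπ₀.le hπ₁.le hε₀ hε₁ P₀ P₁ φ n
      (fun _ => self_mem_contaminationClass hε₀.1 hε₀.2 P₀) hQ
    have h2 := mul_nonneg hπ₀.le (decisionProb_nonneg φ n (fun _ => P₀) true)
    exact lt_of_mul_lt_mul_left (by linarith) hπ₁.le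

lemma tendsto_zero_of_eventually_lt {f : ℕ → ℝ} (h0 : ∀ n, 0 ≤ f n)
    (h : ∀ δ > 0, ∀ᶠ n in atTop, f n < δ) : Tendsto f atTop (𝓝 0) :=
  tendsto_order.2 ⟨fun _ ha => Eventually.of_forall fun n => ha.trans_le (h0 n), h⟩

/-- Myopic rules for uncontaminated classes are greedy for the Bayes error. -/
lemma IsMyopicallyOptimal.isGreedy {π₀ π₁ : ℝ} {P₀ P₁ : Measure Y} [IsProbabilityMeasure P₀]
    [IsProbabilityMeasure P₁] {φ : ℕ → Y × Bool → Bool}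
    (h : IsMyopicallyOptimal π₀ π₁ 0 0 P₀ P₁ φ) :
    IsGreedy (fun b => cond b π₀ π₁) (fun b => cond b P₀ P₁) φ := by
  intro k ψ hψ
  have := (h k).2 ψ hψ
  rwa [maxError_zero_zero, maxError_zero_zero] at this

end Learning

end TandemLearning

end

open TandemLearning in
theorem theorem4 {Y : Type*} [MeasurableSpace Y]
    (P₀ P₁ : Measure Y) [IsProbabilityMeasure P₀] [IsProbabilityMeasure P₁]
    (h₀₁ : P₀ ≪ P₁) (h₁₀ : P₁ ≪ P₀)
    (π₀ π₁ : ℝ) (hπ₀ : 0 < π₀) (hπ₁ : 0 < π₁) (hπ : π₀ + π₁ = 1)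
    (ε₀ ε₁ : ℝ) (hε₀ : 0 ≤ ε₀ ∧ ε₀ < 1) (hε₁ : 0 ≤ ε₁ ∧ ε₁ < 1)
    (hdisj : Disjoint (TandemLearning.contaminationClass ε₀ P₀)
      (TandemLearning.contaminationClass ε₁ P₁))
    (φ : ℕ → Y × Bool → Bool)
    (hφ : TandemLearning.IsMyopicallyOptimal π₀ π₁ ε₀ ε₁ P₀ P₁ φ) :
    Tendsto (fun k : ℕ => TandemLearning.maxError π₀ π₁ ε₀ ε₁ P₀ P₁ φ (k + 1)) atTop (𝓝 0) ↔
      ((ε₀ = 0 ∧ ε₁ = 0) ∧ TandemLearning.UnboundedLLR P₀ P₁) := by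
  have hm : ∀ k, Measurable (φ k) := fun k => (hφ k).1
  have hw : ∀ b, 0 < (fun b => cond b π₀ π₁) b := by
    rintro (_ | _)
    exacts [hπ₁, hπ₀]
  -- The index is the wrong decision, so `true` goes with `P₀`.
  let μ : Bool → Measure Y := fun b => cond b P₀ P₁
  have hμ : ∀ b, IsProbabilityMeasure (μ b) := by
    rintro (_ | _) <;> dsimp only [μ, cond] <;> infer_instance
  have hac : ∀ b c, μ b ≪ μ c := by
    rintro (_ | _) (_ | _)
    exacts [Measure.AbsolutelyContinuous.rfl, h₁₀, h₀₁, Measure.AbsolutelyContinuous.rfl]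
  constructor
  · intro h
    have h' := (tendsto_add_atTop_iff_nat 1).1 h
    have hu := fun δ (hδ : (0 : ℝ) < δ) =>
      eventually_decisionProb_lt hπ₀ hπ₁ hε₀ hε₁ P₀ P₁ φ h' hδ
    have ht : Tendsto (fun n => decisionProb φ n (fun _ => P₀) true) atTop (𝓝 0) :=
      tendsto_zero_of_eventually_lt (fun n => decisionProb_nonneg ..) fun δ hδ =>
        (hu δ hδ).1.mono fun n hn => hn _ fun _ => self_mem_contaminationClass hε₀.1 hε₀.2 P₀
    have hf : Tendsto (fun n => decisionProb φ n (fun _ => P₁) false) atTop (𝓝 0) :=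
      tendsto_zero_of_eventually_lt (fun n => decisionProb_nonneg ..) fun δ hδ =>
        (hu δ hδ).2.mono fun n hn => hn _ fun _ => self_mem_contaminationClass hε₁.1 hε₁.2 P₁
    have he₀ : ε₀ = 0 := by
      by_contra hne
      exact not_learning_of_contamination hm (lt_of_le_of_ne hε₀.1 (Ne.symm hne)) hε₀.2 P₀ P₁ h₀₁
        false (fun δ hδ => (hu δ hδ).1) hf
    have he₁ : ε₁ = 0 := by
      by_contra hne
      exact not_learning_of_contamination hm (lt_of_le_of_ne hε₁.1 (Ne.symm hne)) hε₁.2 P₁ P₀ h₁₀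
        true (fun δ hδ => (hu δ hδ).2) ht
    subst he₀ he₁
    have hlim : ∀ c, Tendsto (fun n => decisionProb φ n (fun _ => μ c) c) atTop (𝓝 0) := by
      rintro (_ | _)
      exacts [hf, ht]
    refine ⟨⟨rfl, rfl⟩, fun c hc => ?_, fun c hc => ?_⟩
    -- An upper bound on the ratio makes `false` irreversible; a lower bound does so for `true`.
    · refine hφ.isGreedy.not_learning_of_bounded (μ := μ) hm hw false hac (C := Real.exp c)
        (fun A hA => ?_) hlim
      exact measureReal_le_exp_mul h₀₁ h₁₀ hA (hc.mono fun y hy _ => hy)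
    · refine hφ.isGreedy.not_learning_of_bounded (μ := μ) hm hw true hac (C := Real.exp (-c))
        (fun A hA => ?_) hlim
      have h1 := exp_mul_le_measureReal h₀₁ h₁₀ hA (hc.mono fun y hy _ => hy)
      rw [Real.exp_neg, inv_mul_eq_div, le_div_iff₀ (Real.exp_pos c), mul_comm]
      exact h1
  · rintro ⟨⟨rfl, rfl⟩, hA, hB⟩
    have hf := hφ.isGreedy.tendsto_decisionProb (μ := μ) hm hw false
      (exists_mul_le_of_unbounded_above h₀₁ h₁₀ hA)
    have ht := hφ.isGreedy.tendsto_decisionProb (μ := μ) hm hw true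
      (exists_mul_le_of_unbounded_below h₀₁ h₁₀ hB)
    simp only [maxError_zero_zero]
    simpa [μ, Function.comp_def] using
      ((ht.const_mul π₀).add (hf.const_mul π₁)).comp (tendsto_add_atTop_nat 1)
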